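/- A source sends packets $0,1,2,\dots$ to a server over a channel, and the server processes them and delivers them to a destination. Packet $k$ has transmission time $T_k\ge 0$ and processing time $C_k\ge 0$. The pairs $(T_k,C_k)$, $k\ge 0$, are independent, and for $k\ge 1$ they are distributed as $(T,C)$, where $\mathbb E[T],\mathbb E[C]<\infty$ and $\mathbb E[T]+\mathbb E[C]>0$; also $\mathbb E[(T_0+C_0)^2]<\infty$. Packet $0$ is sent at $t_0=-T_0-C_0$ and its processing starts at $c_0=-C_0$. For $k\ge 1$, packet $k$ is sent at $t_k=t_{k-1}+T_{k-1}+W_k$, its processing starts at $c_k=\max\{t_k+T_k,\;c_{k-1}+C_{k-1}\}$, and it is delivered at $d_k=c_k+C_k$. A (causal) long wait policy chooses each $W_k$ as a measurable function of $(T_0,C_0),\dots,(T_{k-1},C_{k-1})$ so that, almost surely, $t_k\ge d_{k-1}$ (a packet is sent only after the previous one has been delivered), with $\mathbb E[T_{k-1}+W_k]<\infty$. It is stationary deterministic if $W_k=h(T_{k-1},C_{k-1})$ for a fixed function $h$. With $Q_k=\tfrac12(d_k-t_{k-1})^2-\tfrac12(d_k-t_k)^2$, the area under the age curve belonging to packet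 $k$, the average age of information of a policy is $$\overline\Delta=\lim_{n\to\infty}\frac{\mathbb E\big[\sum_{k=1}^n Q_k\big]}{\mathbb E\big[\sum_{k=1}^n (T_{k-1}+W_k)\big]}\in[0,\infty].$$ For $\beta>0$ let $h_\beta(T,C)=\max\{C,\beta-T\}$, and consider the equation $$\mathbb E[T+h_\beta(T,C)]=\frac{\mathbb E\big[(T+h_\beta(T,C))^2\big]}{2\beta},\qquad (*)$$ where both expectations are required to be finite. (i) If $\mathbb E[(T+C)^2]<\infty$, then $(*)$ has exactly one solution $\beta>0$. (ii) If $\beta>0$ satisfies $(*)$, then the rule $W_k=h_\beta(T_{k-1},C_{k-1})=\max\{C_{k-1},\beta-T_{k-1}\}$ is an optimal long wait policy: its average age exists, equals $\beta+\mathbb E[T]+\mathbb E[C]$, and is at most the average age of every causal long wait policy (at most its lower limit, if the limit does not exist). Its inter-send times are $t_k-t_{k-1}=\max\{\beta,\,T_{k-1}+C_{k-1}\}$. Any optimal long wait policy of the stationary deterministic form $W_k=h(T_{k-1},C_{k-1})$ satisfies $h(T,C)=h_\beta(T,C)$ almost surely. -/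

import Mathlib

open MeasureTheory ProbabilityTheory Filter Topology
open scoped ENNReal

namespace AoI

/-- A causal waiting policy for a source that sends a packet only after the previous one has been
delivered. At that moment the transmission and processing times of packets `0, …, k` are all known,
and `π k` turns them into the waiting time `W_{k+1}`. -/
abbrev Policy : Type := (k : ℕ) → (Fin (k + 1) → ℝ × ℝ) → ℝ

/-- The stationary deterministic policy `W_{k+1} = h (T_k, C_k)`. -/
def stationary (h : ℝ → ℝ → ℝ) : Policy :=
  fun k x => h (x (Fin.last k)).1 (x (Fin.last k)).2

/-- The threshold rule `h(T, C) = max {C, β - T}`. -/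
def thresholdRule (β : ℝ) (t c : ℝ) : ℝ := max c (β - t)

section System

variable {Ω : Type*} (T C : ℕ → Ω → ℝ) (π : Policy)

/-- `wait T C π k` is `W_{k+1}`, the time the source waits between the arrival of packet `k` at the
server and the sending of packet `k + 1`. -/
def wait (k : ℕ) (ω : Ω) : ℝ := π k (fun i => (T i ω, C i ω))

/-- Generation (sending) time `t_k`: `t_0 = -T_0 - C_0` and `t_{k+1} = t_k + T_k + W_{k+1}`. -/
def sendTime : ℕ → Ω → ℝ
  | 0, ω => -T 0 ω - C 0 ω
  | k + 1, ω => sendTime k ω + T k ω + wait T C π k ω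

/-- Time `c_k` at which the server starts packet `k`: `c_0 = -C_0` and
`c_{k+1} = max {t_{k+1} + T_{k+1}, c_k + C_k}`. -/
def startTime : ℕ → Ω → ℝ
  | 0, ω => -C 0 ω
  | k + 1, ω => max (sendTime T C π (k + 1) ω + T (k + 1) ω) (startTime k ω + C k ω)

/-- Delivery time `d_k = c_k + C_k`. -/
def deliveryTime (k : ℕ) (ω : Ω) : ℝ := startTime T C π k ω + C k ω

/-- The trapezoid `Q_{k+1} = (d_{k+1} - t_k)² / 2 - (d_{k+1} - t_{k+1})² / 2` under the age curve. -/
noncomputable def ageArea (k : ℕ) (ω : Ω) : ℝ :=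
  (deliveryTime T C π (k + 1) ω - sendTime T C π k ω) ^ 2 / 2
    - (deliveryTime T C π (k + 1) ω - sendTime T C π (k + 1) ω) ^ 2 / 2

variable [MeasurableSpace Ω] (P : Measure Ω)

/-- A long wait policy: measurable decisions, and packet `k + 1` is sent only after packet `k` has
been delivered. The expected intervals between sendings are finite, so that the denominator of the
average age is a finite number. -/
structure IsLongWait : Prop where
  measurable : ∀ k, Measurable (π k)
  send_after_delivery : ∀ k, ∀ᵐ ω ∂P, deliveryTime T C π k ω ≤ sendTime T C π (k + 1) ω
  integrable_interval : ∀ k, Integrable (fun ω => T k ω + wait T C π k ω) P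

/-- `𝔼[Q_1 + ⋯ + Q_n] / 𝔼[(T_0 + W_1) + ⋯ + (T_{n-1} + W_n)]`. Under a long wait policy all the
summands are almost surely nonnegative; the numerator may be `∞`. -/
noncomputable def meanAge (n : ℕ) : ℝ≥0∞ :=
  (∫⁻ ω, ENNReal.ofReal (∑ k ∈ Finset.range n, ageArea T C π k ω) ∂P) /
    (∫⁻ ω, ENNReal.ofReal (∑ k ∈ Finset.range n, (T k ω + wait T C π k ω)) ∂P)

/-- `π` minimizes the long-term average age `lim_n meanAge n` among long wait policies. The upper
limit for `π` is compared with the lower limit for every competitor, so the limit exists for `π`,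
and competitors need not have one. -/
def IsOptimalLongWait : Prop :=
  IsLongWait T C π P ∧
    ∀ π' : Policy, IsLongWait T C π' P →
      limsup (meanAge T C π P) atTop ≤ liminf (meanAge T C π' P) atTop

end System

/-- `β` is a positive solution of `𝔼[T + h(T, C)] = 𝔼[(T + h(T, C))²] / (2β)` with
`h(T, C) = max {C, β - T}`, both expectations being finite. -/
def IsThreshold {Ω : Type*} [MeasurableSpace Ω] (P : Measure Ω) (T C : Ω → ℝ) (β : ℝ) : Prop :=
  0 < β ∧ MemLp (fun ω => T ω + thresholdRule β (T ω) (C ω)) 2 P ∧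
    ∫ ω, (T ω + thresholdRule β (T ω) (C ω)) ∂P
      = (∫ ω, (T ω + thresholdRule β (T ω) (C ω)) ^ 2 ∂P) / (2 * β)

end AoI

/-! Write `S_k = T_k + C_k`, `Y_k = t_{k+1} - t_k` and `M` for the mean of `S_1`. Under a long wait
policy no packet queues, so `d_k = t_k + S_k`, `Y_k ≥ S_k` and the age area is `Y_k²/2 + Y_k
S_{k+1}` (`ageArea_eq`). Causality makes `Y_k` independent of `S_{k+1}`, so the average age is `M`
plus the limit of `∑ 𝔼[Y_k²/2] / ∑ 𝔼[Y_k]`. This fractional problem is solved pointwise: over `y ≥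
s`, `y²/2 - β y` is minimal at `max β s` (`sq_gap`), and `(*)` says exactly that this minimum has
mean zero. Hence `𝔼[Y_k²/2] ≥ β 𝔼[Y_k]` for `k ≥ 1`, with equality for the threshold rule; the
quadratic gap (`IsThreshold.add_gap_le`) gives uniqueness. Packet 0 contributes a bounded error,
which vanishes because `∑ 𝔼[Y_k]` diverges. For existence of `β`, `(*)` becomes `𝔼[((S - β)⁺)²] =
β²`: a nonincreasing function meets an increasing one. -/

namespace AoI

/-! ### Asymptotics of ratios with a bounded error -/

section Limits

variable {A D : ℕ → ℝ≥0∞} {r K M : ℝ≥0∞}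

/-- `K` absorbs packet 0, whose law differs from the others; `K / D n` tends to `0`. `A n` may be
infinite. -/
lemma le_liminf_ratio (hK : K ≠ ∞) (hr : r ≠ ∞) (hD : ∀ n, D n ≠ ∞) (hDtop : Tendsto D atTop (𝓝 ∞))
    (h : ∀ n, r * D n ≤ A n + K) :
    r + M ≤ liminf (fun n => (A n + D n * M) / D n) atTop := by
  have hlim : Tendsto (fun n => r - K / D n + M) atTop (𝓝 (r + M)) := by
    have h1 : Tendsto (fun n => K / D n) atTop (𝓝 0) := by
      simpa using ENNReal.Tendsto.const_div hDtop (Or.inr hK)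
    have h2 := ENNReal.Tendsto.sub (tendsto_const_nhds (x := r)) h1 (Or.inl hr)
    simpa using h2.add_const M
  rw [← hlim.liminf_eq]
  refine liminf_le_liminf ?_
  filter_upwards [hDtop.eventually (lt_mem_nhds ENNReal.zero_lt_top)] with n hn
  rw [ENNReal.add_div, mul_div_assoc, ENNReal.mul_div_cancel hn.ne' (hD n)]
  gcongr
  rw [tsub_le_iff_right, ← ENNReal.add_div, ENNReal.le_div_iff_mul_le (Or.inl hn.ne') (Or.inl (hD n))]
  exact h n

lemma limsup_ratio_le (hK : K ≠ ∞) (hD : ∀ n, D n ≠ ∞) (hDtop : Tendsto D atTop (𝓝 ∞))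
    (h : ∀ n, A n ≤ r * D n + K) :
    limsup (fun n => (A n + D n * M) / D n) atTop ≤ r + M := by
  have hlim : Tendsto (fun n => r + K / D n + M) atTop (𝓝 (r + M)) := by
    have h1 : Tendsto (fun n => K / D n) atTop (𝓝 0) := by
      simpa using ENNReal.Tendsto.const_div hDtop (Or.inr hK)
    simpa using (h1.const_add r).add_const M
  rw [← hlim.limsup_eq]
  refine limsup_le_limsup ?_
  filter_upwards [hDtop.eventually (lt_mem_nhds ENNReal.zero_lt_top)] with n hn
  rw [ENNReal.div_le_iff hn.ne' (hD n), add_mul, add_mul, ENNReal.div_mul_cancel hn.ne' (hD n),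
    mul_comm M]
  gcongr
  exact h n

end Limits

/-! ### Sample-path identities -/

section Pathwise

variable {Ω : Type*} {T C : ℕ → Ω → ℝ} {π : Policy} {ω : Ω}

/-- The interval `t_{k+1} - t_k = T_k + W_{k+1}` between two sendings. -/
def interval (T C : ℕ → Ω → ℝ) (π : Policy) (k : ℕ) (ω : Ω) : ℝ := T k ω + wait T C π k ω

lemma sendTime_succ (k : ℕ) :
    sendTime T C π (k + 1) ω = sendTime T C π k ω + interval T C π k ω := by
  simp [sendTime, interval, add_assoc]

lemma deliveryTime_zero :
    deliveryTime T C π 0 ω = sendTime T C π 0 ω + (T 0 ω + C 0 ω) := by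
  simp [deliveryTime, startTime, sendTime]

lemma deliveryTime_succ (hT : ∀ k, 0 ≤ T k ω) {k : ℕ}
    (h : deliveryTime T C π k ω ≤ sendTime T C π (k + 1) ω) :
    deliveryTime T C π (k + 1) ω
      = sendTime T C π (k + 1) ω + (T (k + 1) ω + C (k + 1) ω) := by
  have : startTime T C π k ω + C k ω ≤ sendTime T C π (k + 1) ω + T (k + 1) ω :=
    h.trans (le_add_of_nonneg_right (hT _))
  rw [deliveryTime, startTime, max_eq_left this, add_assoc]

lemma deliveryTime_eq_of_long_wait (hT : ∀ k, 0 ≤ T k ω)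
    (h : ∀ k, deliveryTime T C π k ω ≤ sendTime T C π (k + 1) ω) :
    ∀ k, deliveryTime T C π k ω = sendTime T C π k ω + (T k ω + C k ω)
  | 0 => deliveryTime_zero
  | k + 1 => deliveryTime_succ hT (h k)

/-- Serves to verify that a rule is long wait: sending after delivery is not yet known and is
obtained along the induction. -/
lemma deliveryTime_eq_of_sojourn_le (hT : ∀ k, 0 ≤ T k ω)
    (h : ∀ k, T k ω + C k ω ≤ interval T C π k ω) (k : ℕ) :
    deliveryTime T C π k ω = sendTime T C π k ω + (T k ω + C k ω) := by
  induction k with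
  | zero => exact deliveryTime_zero
  | succ k ih =>
    refine deliveryTime_succ hT ?_
    rw [ih, sendTime_succ]
    gcongr
    exact h k

lemma ageArea_eq {k : ℕ} (h : deliveryTime T C π (k + 1) ω
      = sendTime T C π (k + 1) ω + (T (k + 1) ω + C (k + 1) ω)) :
    ageArea T C π k ω = interval T C π k ω ^ 2 / 2
      + interval T C π k ω * (T (k + 1) ω + C (k + 1) ω) := by
  rw [ageArea, h, sendTime_succ]
  ring

lemma add_thresholdRule (β t c : ℝ) : t + thresholdRule β t c = max β (t + c) := by
  rw [thresholdRule, ← max_add_add_left, max_comm]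
  congr 1
  ring

lemma interval_stationary (h : ℝ → ℝ → ℝ) (k : ℕ) :
    interval T C (stationary h) k ω = T k ω + h (T k ω) (C k ω) := by
  simp [interval, wait, stationary]

lemma interval_threshold (β : ℝ) (k : ℕ) :
    interval T C (stationary (thresholdRule β)) k ω = max β (T k ω + C k ω) := by
  rw [interval_stationary, add_thresholdRule]

/-- Among `y ≥ s`, the strongly convex function `y ↦ y ^ 2 / 2 - β * y` is smallest at
`max β s`. -/
lemma sq_gap {β s y : ℝ} (h : s ≤ y) :
    max β s ^ 2 / 2 + β * y + (y - max β s) ^ 2 / 2 ≤ y ^ 2 / 2 + β * max β s := by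
  rcases le_total β s with hs | hs
  · rw [max_eq_right hs]
    -- The slack is `(y - s)(s - β)`; in the other case there is equality.
    nlinarith [mul_nonneg (sub_nonneg.2 h) (sub_nonneg.2 hs)]
  · rw [max_eq_left hs]
    nlinarith

end Pathwise

/-- The standing assumptions on transmission and processing times. -/
structure IsModel {Ω : Type*} [MeasurableSpace Ω] (P : Measure Ω) (T C : ℕ → Ω → ℝ) : Prop where
  measT : ∀ k, Measurable (T k)
  measC : ∀ k, Measurable (C k)
  nonnegT : ∀ k ω, 0 ≤ T k ω
  nonnegC : ∀ k ω, 0 ≤ C k ω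
  indep : iIndepFun (fun k ω => (T k ω, C k ω)) P
  ident : ∀ k, 1 ≤ k → IdentDistrib (fun ω => (T k ω, C k ω)) (fun ω => (T 1 ω, C 1 ω)) P P
  intT : Integrable (T 1) P
  intC : Integrable (C 1) P
  mean_pos : 0 < (∫ ω, T 1 ω ∂P) + (∫ ω, C 1 ω ∂P)

/-- The mean time a packet spends in the system. -/
noncomputable def meanSojourn {Ω : Type*} [MeasurableSpace Ω] (P : Measure Ω)
    (T C : ℕ → Ω → ℝ) : ℝ := (∫ ω, T 1 ω ∂P) + (∫ ω, C 1 ω ∂P)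

/-! ### Average age of a general long wait policy -/

section Average

variable {Ω : Type*} [MeasurableSpace Ω] {P : Measure Ω} {T C : ℕ → Ω → ℝ} {π : Policy}

lemma IsModel.measurable_interval (hm : IsModel P T C) (hπ : ∀ k, Measurable (π k)) (k : ℕ) :
    Measurable (interval T C π k) :=
  (hm.measT k).add ((hπ k).comp (measurable_pi_lambda _ fun i =>
    (hm.measT i).prodMk (hm.measC i)))

lemma IsModel.measurable_sojourn (hm : IsModel P T C) (k : ℕ) :
    Measurable fun ω => T k ω + C k ω := (hm.measT k).add (hm.measC k)

lemma IsModel.lintegral_comp (hm : IsModel P T C) {f : ℝ × ℝ → ℝ≥0∞} (hf : Measurable f) {k : ℕ}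
    (hk : 1 ≤ k) : ∫⁻ ω, f (T k ω, C k ω) ∂P = ∫⁻ ω, f (T 1 ω, C 1 ω) ∂P :=
  ((hm.ident k hk).comp hf).lintegral_eq

lemma IsModel.lintegral_sojourn (hm : IsModel P T C) {k : ℕ} (hk : 1 ≤ k) :
    ∫⁻ ω, ENNReal.ofReal (T k ω + C k ω) ∂P = ENNReal.ofReal (meanSojourn P T C) := by
  rw [hm.lintegral_comp (f := fun x => ENNReal.ofReal (x.1 + x.2)) (by fun_prop) hk,
    meanSojourn, ← integral_add hm.intT hm.intC]
  exact (ofReal_integral_eq_lintegral_ofReal (hm.intT.add hm.intC)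
    (ae_of_all _ fun ω => add_nonneg (hm.nonnegT 1 ω) (hm.nonnegC 1 ω))).symm

/-- The interval depends only on packets `0, …, k`, a block disjoint from `{k + 1}`. -/
lemma IsModel.indep_interval_sojourn (hm : IsModel P T C) (hπ : ∀ k, Measurable (π k)) (k : ℕ) :
    IndepFun (interval T C π k) (fun ω => T (k + 1) ω + C (k + 1) ω) P := by
  have key := hm.indep.indepFun_finset (Finset.range (k + 1)) {k + 1} (by simp)
    fun i => (hm.measT i).prodMk (hm.measC i)
  have hφ : Measurable fun x : Finset.range (k + 1) → ℝ × ℝ =>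
      (x ⟨k, by simp⟩).1 + π k (fun i => x ⟨i, Finset.mem_range.2 i.2⟩) :=
    (measurable_fst.comp (measurable_pi_apply _)).add
      ((hπ k).comp (measurable_pi_lambda _ fun i => measurable_pi_apply _))
  have hψ : Measurable fun x : ({k + 1} : Finset ℕ) → ℝ × ℝ =>
      (x ⟨k + 1, by simp⟩).1 + (x ⟨k + 1, by simp⟩).2 :=
    (measurable_fst.comp (measurable_pi_apply _)).add
      (measurable_snd.comp (measurable_pi_apply _))
  exact key.comp hφ hψ

lemma IsLongWait.ae_deliveryTime_eq (hm : IsModel P T C) (h : IsLongWait T C π P) :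
    ∀ᵐ ω ∂P, ∀ k, deliveryTime T C π k ω = sendTime T C π k ω + (T k ω + C k ω) := by
  filter_upwards [ae_all_iff.2 h.send_after_delivery] with ω hω
  exact deliveryTime_eq_of_long_wait (fun k => hm.nonnegT k ω) hω

lemma IsLongWait.ae_sojourn_le (hm : IsModel P T C) (h : IsLongWait T C π P) :
    ∀ᵐ ω ∂P, ∀ k, T k ω + C k ω ≤ interval T C π k ω := by
  filter_upwards [ae_all_iff.2 h.send_after_delivery, h.ae_deliveryTime_eq hm] with ω h1 h2 k
  have := h1 k
  rw [h2 k, sendTime_succ] at this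
  linarith

/-- `𝔼[(t_{k+1} - t_k)² / 2]`. -/
noncomputable def halfSq (T C : ℕ → Ω → ℝ) (π : Policy) (P : Measure Ω) (k : ℕ) : ℝ≥0∞ :=
  ∫⁻ ω, ENNReal.ofReal (interval T C π k ω ^ 2 / 2) ∂P

/-- `𝔼[t_{k+1} - t_k]`. -/
noncomputable def meanInterval (T C : ℕ → Ω → ℝ) (π : Policy) (P : Measure Ω) (k : ℕ) : ℝ≥0∞ :=
  ∫⁻ ω, ENNReal.ofReal (interval T C π k ω) ∂P

lemma IsLongWait.lintegral_ageArea (hm : IsModel P T C) (h : IsLongWait T C π P) (k : ℕ) :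
    ∫⁻ ω, ENNReal.ofReal (ageArea T C π k ω) ∂P
      = halfSq T C π P k + meanInterval T C π P k * ENNReal.ofReal (meanSojourn P T C) := by
  have hY := hm.measurable_interval h.measurable k
  have hS := hm.measurable_sojourn (k + 1)
  rw [← hm.lintegral_sojourn (Nat.le_add_left 1 k), halfSq, meanInterval,
    ← lintegral_mul_eq_lintegral_mul_lintegral_of_indepFun hY.ennreal_ofReal hS.ennreal_ofReal
      ((hm.indep_interval_sojourn h.measurable k).comp ENNReal.measurable_ofReal
        ENNReal.measurable_ofReal),
    ← lintegral_add_left (by fun_prop)]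
  refine lintegral_congr_ae ?_
  filter_upwards [h.ae_deliveryTime_eq hm, h.ae_sojourn_le hm] with ω h1 h2
  have hs : ∀ j, 0 ≤ T j ω + C j ω := fun j => add_nonneg (hm.nonnegT j ω) (hm.nonnegC j ω)
  have hy := (hs k).trans (h2 k)
  rw [ageArea_eq (h1 (k + 1)), ENNReal.ofReal_add (by positivity) (mul_nonneg hy (hs _)),
    ENNReal.ofReal_mul hy]
  rfl

lemma IsLongWait.meanAge_eq (hm : IsModel P T C) (h : IsLongWait T C π P) (n : ℕ) :
    meanAge T C π P n = (∑ k ∈ Finset.range n, halfSq T C π P k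
      + (∑ k ∈ Finset.range n, meanInterval T C π P k) * ENNReal.ofReal (meanSojourn P T C))
        / ∑ k ∈ Finset.range n, meanInterval T C π P k := by
  have hY := hm.measurable_interval h.measurable
  have hnn : ∀ᵐ ω ∂P, ∀ k, 0 ≤ interval T C π k ω ∧ 0 ≤ ageArea T C π k ω := by
    filter_upwards [h.ae_deliveryTime_eq hm, h.ae_sojourn_le hm] with ω h1 h2 k
    have hs : ∀ j, 0 ≤ T j ω + C j ω := fun j => add_nonneg (hm.nonnegT j ω) (hm.nonnegC j ω)
    have hy := (hs k).trans (h2 k)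
    refine ⟨hy, ?_⟩
    rw [ageArea_eq (h1 (k + 1))]
    have := mul_nonneg hy (hs (k + 1))
    positivity
  have hQ : ∀ k, AEMeasurable (fun ω => ENNReal.ofReal (ageArea T C π k ω)) P := fun k => by
    have : Measurable fun ω => ENNReal.ofReal (interval T C π k ω ^ 2 / 2
        + interval T C π k ω * (T (k + 1) ω + C (k + 1) ω)) := by
      have := hY k
      have := hm.measurable_sojourn (k + 1)
      fun_prop
    refine this.aemeasurable.congr ?_
    filter_upwards [h.ae_deliveryTime_eq hm] with ω h1
    rw [ageArea_eq (h1 (k + 1))]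
  have num : ∫⁻ ω, ENNReal.ofReal (∑ k ∈ Finset.range n, ageArea T C π k ω) ∂P
      = ∑ k ∈ Finset.range n, halfSq T C π P k
      + (∑ k ∈ Finset.range n, meanInterval T C π P k)
        * ENNReal.ofReal (meanSojourn P T C) := by
    rw [Finset.sum_mul, ← Finset.sum_add_distrib]
    simp_rw [← h.lintegral_ageArea hm]
    rw [← lintegral_finsetSum' _ fun k _ => hQ k]
    refine lintegral_congr_ae ?_
    filter_upwards [hnn] with ω hω
    exact ENNReal.ofReal_sum_of_nonneg fun k _ => (hω k).2
  have den : ∫⁻ ω, ENNReal.ofReal (∑ k ∈ Finset.range n, (T k ω + wait T C π k ω)) ∂P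
      = ∑ k ∈ Finset.range n, meanInterval T C π P k := by
    simp_rw [meanInterval]
    rw [← lintegral_finsetSum _ fun k _ => (hY k).ennreal_ofReal]
    refine lintegral_congr_ae ?_
    filter_upwards [hnn] with ω hω
    exact ENNReal.ofReal_sum_of_nonneg fun k _ => (hω k).1
  rw [meanAge, num, den]

lemma IsLongWait.meanInterval_ne_top (h : IsLongWait T C π P) (k : ℕ) :
    meanInterval T C π P k ≠ ∞ :=
  (h.integrable_interval k).lintegral_lt_top.ne

lemma IsLongWait.meanSojourn_le (hm : IsModel P T C) (h : IsLongWait T C π P) {k : ℕ}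
    (hk : 1 ≤ k) : ENNReal.ofReal (meanSojourn P T C) ≤ meanInterval T C π P k := by
  rw [← hm.lintegral_sojourn hk]
  refine lintegral_mono_ae ?_
  filter_upwards [h.ae_sojourn_le hm] with ω hω
  exact ENNReal.ofReal_le_ofReal (hω k)

lemma IsLongWait.tendsto_sum_meanInterval (hm : IsModel P T C) (h : IsLongWait T C π P) :
    Tendsto (fun n => ∑ k ∈ Finset.range n, meanInterval T C π P k) atTop (𝓝 ∞) := by
  have hM : ENNReal.ofReal (meanSojourn P T C) ≠ 0 := by
    simpa [meanSojourn] using hm.mean_pos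
  have h1 : Tendsto (fun n : ℕ => (n : ℝ≥0∞) * ENNReal.ofReal (meanSojourn P T C)) atTop
      (𝓝 ∞) := by
    have := ENNReal.Tendsto.mul_const (b := ENNReal.ofReal (meanSojourn P T C))
      ENNReal.tendsto_nat_nhds_top (Or.inl ENNReal.top_ne_zero)
    rwa [ENNReal.top_mul hM] at this
  -- Shifting by one isolates packet 0, to which the lower bound by the mean sojourn need not apply.
  rw [← tendsto_add_atTop_iff_nat 1]
  refine tendsto_of_tendsto_of_tendsto_of_le_of_le h1 tendsto_const_nhds (fun n => ?_)
    fun n => le_top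
  rw [Finset.sum_range_succ']
  refine le_trans ?_ (le_add_of_nonneg_right zero_le)
  simpa using Finset.card_nsmul_le_sum (Finset.range n) (fun k => meanInterval T C π P (k + 1)) _
    fun k _ => h.meanSojourn_le hm (Nat.le_add_left 1 k)

lemma IsLongWait.le_liminf_meanAge (hm : IsModel P T C) (h : IsLongWait T C π P) {r K : ℝ≥0∞}
    (hr : r ≠ ∞) (hK : K ≠ ∞) (h0 : r * meanInterval T C π P 0 ≤ halfSq T C π P 0 + K)
    (hs : ∀ k, 1 ≤ k → r * meanInterval T C π P k ≤ halfSq T C π P k) :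
    r + ENNReal.ofReal (meanSojourn P T C) ≤ liminf (meanAge T C π P) atTop := by
  rw [funext (h.meanAge_eq hm)]
  refine le_liminf_ratio hK hr
    (fun n => ENNReal.sum_ne_top.2 fun k _ => h.meanInterval_ne_top k)
    (h.tendsto_sum_meanInterval hm) fun n => ?_
  cases n with
  | zero => simp
  | succ n =>
    rw [Finset.sum_range_succ', Finset.sum_range_succ', mul_add, Finset.mul_sum, add_assoc]
    exact add_le_add (Finset.sum_le_sum fun k _ => hs (k + 1) (Nat.le_add_left 1 k)) h0

lemma IsLongWait.limsup_meanAge_le (hm : IsModel P T C) (h : IsLongWait T C π P) {r : ℝ≥0∞}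
    (h0 : halfSq T C π P 0 ≠ ∞)
    (hs : ∀ k, 1 ≤ k → halfSq T C π P k ≤ r * meanInterval T C π P k) :
    limsup (meanAge T C π P) atTop ≤ r + ENNReal.ofReal (meanSojourn P T C) := by
  rw [funext (h.meanAge_eq hm)]
  refine limsup_ratio_le h0
    (fun n => ENNReal.sum_ne_top.2 fun k _ => h.meanInterval_ne_top k)
    (h.tendsto_sum_meanInterval hm) fun n => ?_
  cases n with
  | zero => simp
  | succ n =>
    rw [Finset.sum_range_succ', Finset.sum_range_succ', mul_add, Finset.mul_sum]
    exact add_le_add ((Finset.sum_le_sum fun k _ => hs (k + 1) (Nat.le_add_left 1 k)).trans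
      le_self_add) le_rfl

end Average

/-! ### Optimality and uniqueness of the threshold rule -/

section Threshold

variable {Ω : Type*} [MeasurableSpace Ω] {P : Measure Ω} {T C : ℕ → Ω → ℝ} {π : Policy} {β : ℝ}

lemma isThreshold_iff {T C : Ω → ℝ} : IsThreshold P T C β ↔
    0 < β ∧ MemLp (fun ω => max β (T ω + C ω)) 2 P ∧
      ∫ ω, max β (T ω + C ω) ∂P = (∫ ω, max β (T ω + C ω) ^ 2 ∂P) / (2 * β) := by
  simp_rw [IsThreshold, add_thresholdRule]

lemma IsThreshold.halfSq_eq [IsProbabilityMeasure P] (hm : IsModel P T C)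
    (hβ : IsThreshold P (T 1) (C 1) β) {k : ℕ} (hk : 1 ≤ k) :
    ∫⁻ ω, ENNReal.ofReal (max β (T k ω + C k ω) ^ 2 / 2) ∂P
      = ENNReal.ofReal β * ∫⁻ ω, ENNReal.ofReal (max β (T k ω + C k ω)) ∂P := by
  obtain ⟨h0, h2, he⟩ := isThreshold_iff.1 hβ
  rw [hm.lintegral_comp (f := fun x => ENNReal.ofReal (max β (x.1 + x.2) ^ 2 / 2))
      (by fun_prop) hk,
    hm.lintegral_comp (f := fun x => ENNReal.ofReal (max β (x.1 + x.2))) (by fun_prop) hk,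
    ← ofReal_integral_eq_lintegral_ofReal (h2.integrable_sq.div_const 2)
      (ae_of_all _ fun ω => by positivity),
    ← ofReal_integral_eq_lintegral_ofReal (h2.integrable one_le_two)
      (ae_of_all _ fun ω => h0.le.trans (le_max_left _ _)),
    ← ENNReal.ofReal_mul h0.le, he, integral_div]
  congr 1
  field_simp

lemma IsThreshold.lintegral_ne_top [IsProbabilityMeasure P] (hm : IsModel P T C)
    (hβ : IsThreshold P (T 1) (C 1) β) {k : ℕ} (hk : 1 ≤ k) :
    ∫⁻ ω, ENNReal.ofReal (max β (T k ω + C k ω)) ∂P ≠ ∞ := by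
  rw [hm.lintegral_comp (f := fun x => ENNReal.ofReal (max β (x.1 + x.2))) (by fun_prop) hk]
  exact ((isThreshold_iff.1 hβ).2.1.integrable one_le_two).lintegral_lt_top.ne

/-- The Lagrangian gap between a long wait policy and the threshold rule. -/
lemma IsThreshold.add_gap_le [IsProbabilityMeasure P] (hm : IsModel P T C)
    (hβ : IsThreshold P (T 1) (C 1) β) (h : IsLongWait T C π P) {k : ℕ} (hk : 1 ≤ k) :
    ENNReal.ofReal β * meanInterval T C π P k
        + ∫⁻ ω, ENNReal.ofReal ((interval T C π k ω - max β (T k ω + C k ω)) ^ 2 / 2) ∂P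
      ≤ halfSq T C π P k := by
  have h0 := hβ.1
  have hY := hm.measurable_interval h.measurable k
  have hS := hm.measurable_sojourn k
  have hfin := ENNReal.mul_ne_top (ENNReal.ofReal_ne_top (r := β)) (hβ.lintegral_ne_top hm hk)
  -- With `Z = max β S_k`, add the finite `β 𝔼[Z]` to both sides and use `(*)` to turn its left copy
  -- into `𝔼[Z²/2]`; the claim is then `sq_gap` integrated.
  rw [← ENNReal.add_le_add_iff_left hfin]
  nth_rw 1 [← hβ.halfSq_eq hm hk]
  rw [meanInterval, halfSq, ← lintegral_const_mul _ (by fun_prop),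
    ← lintegral_const_mul _ (by fun_prop), ← lintegral_add_left (by fun_prop),
    ← lintegral_add_left (by fun_prop), ← lintegral_add_left (by fun_prop)]
  refine lintegral_mono_ae ?_
  filter_upwards [h.ae_sojourn_le hm] with ω hω
  have hy : 0 ≤ interval T C π k ω :=
    (add_nonneg (hm.nonnegT k ω) (hm.nonnegC k ω)).trans (hω k)
  have hz : 0 ≤ max β (T k ω + C k ω) := h0.le.trans (le_max_left _ _)
  rw [← ENNReal.ofReal_mul h0.le, ← ENNReal.ofReal_mul h0.le,
    ← ENNReal.ofReal_add (by positivity) (by positivity),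
    ← ENNReal.ofReal_add (by positivity) (by positivity),
    ← ENNReal.ofReal_add (by positivity) (by positivity)]
  apply ENNReal.ofReal_le_ofReal
  linarith [sq_gap (β := β) (hω k)]

lemma IsThreshold.le_liminf_meanAge [IsProbabilityMeasure P] (hm : IsModel P T C)
    (hβ : IsThreshold P (T 1) (C 1) β) (h : IsLongWait T C π P) :
    ENNReal.ofReal β + ENNReal.ofReal (meanSojourn P T C) ≤ liminf (meanAge T C π P) atTop :=
  h.le_liminf_meanAge hm ENNReal.ofReal_ne_top
    (ENNReal.mul_ne_top ENNReal.ofReal_ne_top (h.meanInterval_ne_top 0)) le_add_self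
    fun _ hk => le_self_add.trans (hβ.add_gap_le hm h hk)

lemma memLp_max_const [IsProbabilityMeasure P] {S : Ω → ℝ} (hS : MemLp S 2 P) (β : ℝ) :
    MemLp (fun ω => max β (S ω)) 2 P :=
  (memLp_const β).sup hS

lemma isLongWait_threshold [IsProbabilityMeasure P] (hm : IsModel P T C)
    (h_init : MemLp (fun ω => T 0 ω + C 0 ω) 2 P) (β : ℝ) :
    IsLongWait T C (stationary (thresholdRule β)) P where
  measurable k := by
    unfold stationary thresholdRule
    fun_prop
  send_after_delivery k := ae_of_all _ fun ω => by
    have h : ∀ k, T k ω + C k ω ≤ interval T C (stationary (thresholdRule β)) k ω := fun k => by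
      rw [interval_threshold]
      exact le_max_right _ _
    rw [deliveryTime_eq_of_sojourn_le (fun k => hm.nonnegT k ω) h, sendTime_succ]
    gcongr
    exact h k
  integrable_interval k := by
    change Integrable (interval T C (stationary (thresholdRule β)) k) P
    have hS : Integrable (fun ω => T k ω + C k ω) P := by
      rcases Nat.eq_zero_or_pos k with rfl | hk
      · exact h_init.integrable one_le_two
      · have hid := (hm.ident k hk).comp (u := fun x : ℝ × ℝ => x.1 + x.2) (by fun_prop)
        exact hid.integrable_iff.2 (hm.intT.add hm.intC)
    exact ((integrable_const β).sup hS).congr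
      (ae_of_all _ fun ω => (interval_threshold β k).symm)

lemma IsThreshold.limsup_meanAge_le [IsProbabilityMeasure P] (hm : IsModel P T C)
    (h_init : MemLp (fun ω => T 0 ω + C 0 ω) 2 P) (hβ : IsThreshold P (T 1) (C 1) β) :
    limsup (meanAge T C (stationary (thresholdRule β)) P) atTop
      ≤ ENNReal.ofReal β + ENNReal.ofReal (meanSojourn P T C) := by
  refine (isLongWait_threshold hm h_init β).limsup_meanAge_le hm ?_ fun k hk => ?_
  · simp_rw [halfSq, interval_threshold]
    exact ((memLp_max_const h_init β).integrable_sq.div_const 2).lintegral_lt_top.ne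
  · simp_rw [halfSq, meanInterval, interval_threshold]
    exact (hβ.halfSq_eq hm hk).le

lemma IsThreshold.isOptimalLongWait [IsProbabilityMeasure P] (hm : IsModel P T C)
    (h_init : MemLp (fun ω => T 0 ω + C 0 ω) 2 P) (hβ : IsThreshold P (T 1) (C 1) β) :
    IsOptimalLongWait T C (stationary (thresholdRule β)) P :=
  ⟨isLongWait_threshold hm h_init β, fun _ h =>
    (hβ.limsup_meanAge_le hm h_init).trans (hβ.le_liminf_meanAge hm h)⟩

lemma IsThreshold.tendsto_meanAge [IsProbabilityMeasure P] (hm : IsModel P T C)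
    (h_init : MemLp (fun ω => T 0 ω + C 0 ω) 2 P) (hβ : IsThreshold P (T 1) (C 1) β) :
    Tendsto (meanAge T C (stationary (thresholdRule β)) P) atTop
      (𝓝 (ENNReal.ofReal β + ENNReal.ofReal (meanSojourn P T C))) :=
  tendsto_of_le_liminf_of_limsup_le
    (hβ.le_liminf_meanAge hm (isLongWait_threshold hm h_init β)) (hβ.limsup_meanAge_le hm h_init)

lemma IsLongWait.measurable_rule {h : ℝ → ℝ → ℝ} (hl : IsLongWait T C (stationary h) P) :
    Measurable fun x : ℝ × ℝ => h x.1 x.2 :=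
  (hl.measurable 0).comp (measurable_pi_lambda (fun (x : ℝ × ℝ) (_ : Fin 1) => x)
    fun _ => measurable_id)

/-- For a stationary rule `𝔼[Y_k²/2] / 𝔼[Y_k]` is the same for all `k ≥ 1`, so its average age is at
least this ratio plus `M`, while optimality caps it at `β + M`. -/
lemma IsThreshold.halfSq_le_of_optimal [IsProbabilityMeasure P] (hm : IsModel P T C)
    (h_init : MemLp (fun ω => T 0 ω + C 0 ω) 2 P) (hβ : IsThreshold P (T 1) (C 1) β)
    {h : ℝ → ℝ → ℝ} (ho : IsOptimalLongWait T C (stationary h) P) :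
    halfSq T C (stationary h) P 1 ≤ ENNReal.ofReal β * meanInterval T C (stationary h) P 1 := by
  obtain ⟨hl, ho⟩ := ho
  have hh := hl.measurable_rule
  have hb0 : meanInterval T C (stationary h) P 1 ≠ 0 := by
    refine (lt_of_lt_of_le ?_ (hl.meanSojourn_le hm le_rfl)).ne'
    simpa [meanSojourn] using hm.mean_pos
  have hsq : ∀ k, 1 ≤ k → halfSq T C (stationary h) P k = halfSq T C (stationary h) P 1 :=
    fun k hk => by
      simp_rw [halfSq, interval_stationary]
      exact hm.lintegral_comp (f := fun x => ENNReal.ofReal ((x.1 + h x.1 x.2) ^ 2 / 2))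
        (by fun_prop) hk
  have hint : ∀ k, 1 ≤ k →
      meanInterval T C (stationary h) P k = meanInterval T C (stationary h) P 1 := fun k hk => by
    simp_rw [meanInterval, interval_stationary]
    exact hm.lintegral_comp (f := fun x => ENNReal.ofReal (x.1 + h x.1 x.2)) (by fun_prop) hk
  have hage : liminf (meanAge T C (stationary h) P) atTop
      ≤ ENNReal.ofReal β + ENNReal.ofReal (meanSojourn P T C) :=
    (liminf_le_limsup).trans <| (ho _ (isLongWait_threshold hm h_init β)).trans
      (hβ.tendsto_meanAge hm h_init).liminf_eq.le
  rw [← ENNReal.div_le_iff hb0 (hl.meanInterval_ne_top 1)]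
  -- The ratio might be infinite, so it is approached by finite `r` from below.
  refine ENNReal.le_of_forall_nnreal_lt fun r hr => ?_
  refine (ENNReal.add_le_add_iff_right ENNReal.ofReal_ne_top).1
    ((hl.le_liminf_meanAge hm ENNReal.coe_ne_top (ENNReal.mul_ne_top ENNReal.coe_ne_top
      (hl.meanInterval_ne_top 0)) le_add_self fun k hk => ?_).trans hage)
  rw [hsq k hk, hint k hk]
  exact (ENNReal.le_div_iff_mul_le (Or.inl hb0) (Or.inl (hl.meanInterval_ne_top 1))).1 hr.le

/-- The upper bound from optimality leaves no room for the quadratic gap, so the gap has integral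
zero. -/
lemma IsThreshold.ae_eq_of_optimal [IsProbabilityMeasure P] (hm : IsModel P T C)
    (h_init : MemLp (fun ω => T 0 ω + C 0 ω) 2 P) (hβ : IsThreshold P (T 1) (C 1) β)
    {h : ℝ → ℝ → ℝ} (ho : IsOptimalLongWait T C (stationary h) P) :
    ∀ᵐ ω ∂P, h (T 1 ω) (C 1 ω) = thresholdRule β (T 1 ω) (C 1 ω) := by
  have hl := ho.1
  have hY := hm.measurable_interval hl.measurable 1
  have hS := hm.measurable_sojourn 1
  have hgap := (hβ.add_gap_le hm hl le_rfl).trans (hβ.halfSq_le_of_optimal hm h_init ho)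
  have hfin := ENNReal.mul_ne_top (ENNReal.ofReal_ne_top (r := β)) (hl.meanInterval_ne_top 1)
  have hzero := nonpos_iff_eq_zero.1
    ((ENNReal.add_le_add_iff_left hfin).1 (hgap.trans_eq (add_zero _).symm))
  rw [lintegral_eq_zero_iff (by fun_prop)] at hzero
  filter_upwards [hzero] with ω hω
  have h1 : (interval T C (stationary h) 1 ω - max β (T 1 ω + C 1 ω)) ^ 2 / 2 ≤ 0 := by
    simpa only [Pi.zero_apply, ENNReal.ofReal_eq_zero] using hω
  have h2 : interval T C (stationary h) 1 ω - max β (T 1 ω + C 1 ω) = 0 := by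
    rw [← sq_eq_zero_iff]
    linarith [sq_nonneg (interval T C (stationary h) 1 ω - max β (T 1 ω + C 1 ω))]
  rw [interval_stationary, ← add_thresholdRule] at h2
  linarith

end Threshold

/-! ### Existence and uniqueness of the threshold -/

section Existence

variable {Ω : Type*} [MeasurableSpace Ω] {P : Measure Ω} {S : Ω → ℝ}

lemma max_sub_sq_le {s β : ℝ} (hs : 0 ≤ s) (hβ : 0 ≤ β) : max (s - β) 0 ^ 2 ≤ s ^ 2 :=
  pow_le_pow_left₀ (le_max_right _ _) (max_le (by linarith) hs) 2

lemma integrable_excess_sq [IsProbabilityMeasure P] (hS : MemLp S 2 P) (β : ℝ) :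
    Integrable (fun ω => max (S ω - β) 0 ^ 2) P :=
  ((hS.sub (memLp_const β)).sup (memLp_const 0)).integrable_sq

/-- With `Z = max β S`, `(S - β)⁺ = Z - β`; expanding the square, `𝔼[Z²] = 2β 𝔼[Z]` turns into the
stated equation. -/
lemma isThreshold_iff_excess [IsProbabilityMeasure P] {T C : Ω → ℝ}
    (hS : MemLp (fun ω => T ω + C ω) 2 P) {β : ℝ} : IsThreshold P T C β ↔
      0 < β ∧ ∫ ω, max (T ω + C ω - β) 0 ^ 2 ∂P = β ^ 2 := by
  rw [isThreshold_iff]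
  refine and_congr_right fun h0 => ?_
  have hZ := memLp_max_const hS β
  have hpt : ∀ ω, max (T ω + C ω - β) 0 ^ 2
      = max β (T ω + C ω) ^ 2 - 2 * β * max β (T ω + C ω) + β ^ 2 := fun ω => by
    rcases le_total β (T ω + C ω) with h | h
    · rw [max_eq_right h, max_eq_left (by linarith)]; ring
    · rw [max_eq_left h, max_eq_right (by linarith)]; ring
  have hI : ∫ ω, max (T ω + C ω - β) 0 ^ 2 ∂P
      = ∫ ω, max β (T ω + C ω) ^ 2 ∂P - 2 * β * ∫ ω, max β (T ω + C ω) ∂P + β ^ 2 := by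
    have i1 := hZ.integrable_sq
    have i2 := (hZ.integrable one_le_two).const_mul (2 * β)
    simp_rw [hpt]
    have i3 : Integrable (fun ω => max β (T ω + C ω) ^ 2 - 2 * β * max β (T ω + C ω)) P :=
      i1.sub i2
    rw [integral_add i3 (integrable_const _), integral_sub i1 i2, integral_const_mul]
    simp
  rw [hI, eq_div_iff (by positivity), and_iff_right hZ]
  constructor <;> intro h <;> linarith

lemma continuousOn_excess [IsProbabilityMeasure P] (hS : MemLp S 2 P) (hn : ∀ ω, 0 ≤ S ω) :
    ContinuousOn (fun β => ∫ ω, max (S ω - β) 0 ^ 2 ∂P) (Set.Ici 0) := by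
  refine continuousOn_of_dominated (bound := fun ω => S ω ^ 2)
    (fun β _ => (integrable_excess_sq hS β).aestronglyMeasurable)
    (fun β hβ => ae_of_all _ fun ω => ?_) hS.integrable_sq (ae_of_all _ fun ω => by fun_prop)
  rw [Real.norm_of_nonneg (by positivity)]
  exact max_sub_sq_le (hn ω) hβ

lemma existsUnique_threshold [IsProbabilityMeasure P] {T C : Ω → ℝ}
    (hn : ∀ ω, 0 ≤ T ω + C ω) (hS : MemLp (fun ω => T ω + C ω) 2 P)
    (hpos : 0 < ∫ ω, (T ω + C ω) ∂P) : ∃! β : ℝ, IsThreshold P T C β := by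
  simp_rw [isThreshold_iff_excess hS]
  set F : ℝ → ℝ := fun β => ∫ ω, max (T ω + C ω - β) 0 ^ 2 ∂P with hF
  have hanti : Antitone F := fun a b hab => by
    refine integral_mono (integrable_excess_sq hS b) (integrable_excess_sq hS a) fun ω => ?_
    exact pow_le_pow_left₀ (le_max_right _ _) (max_le_max (by linarith) le_rfl) 2
  have hF0 : F 0 = ∫ ω, (T ω + C ω) ^ 2 ∂P := by
    simp only [hF, sub_zero]
    exact integral_congr_ae (ae_of_all _ fun ω => by simp only [max_eq_left (hn ω)])
  have hF0pos : 0 < F 0 := by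
    refine lt_of_le_of_ne (by rw [hF0]; positivity) fun h => hpos.ne' ?_
    rw [hF0, eq_comm, integral_eq_zero_iff_of_nonneg (fun ω => sq_nonneg _)
      hS.integrable_sq] at h
    refine integral_eq_zero_of_ae ?_
    filter_upwards [h] with ω hω
    exact sq_eq_zero_iff.1 hω
  -- Chosen so that `F b ≤ F 0 = b²`, which gives the sign change on `[0, b]`.
  set b : ℝ := Real.sqrt (F 0) with hb
  have hb0 : 0 ≤ b := Real.sqrt_nonneg _
  have hcont : ContinuousOn (fun β => F β - β ^ 2) (Set.Icc 0 b) :=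
    ((continuousOn_excess hS hn).mono Set.Icc_subset_Ici_self).sub (by fun_prop)
  have hmem : (0 : ℝ) ∈ Set.Icc (F b - b ^ 2) (F 0 - 0 ^ 2) :=
    ⟨by rw [hb, Real.sq_sqrt hF0pos.le]; linarith [hanti hb0], by simpa using hF0pos.le⟩
  obtain ⟨β, hβ, hβe⟩ := intermediate_value_Icc' hb0 hcont hmem
  have hβe : F β = β ^ 2 := by simpa [sub_eq_zero] using hβe
  have hβ0 : 0 < β := hβ.1.lt_of_ne fun h => by
    rw [← h] at hβe
    simp only [ne_eq, OfNat.ofNat_ne_zero, not_false_eq_true, zero_pow] at hβe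
    exact hF0pos.ne' hβe
  refine ⟨β, ⟨hβ0, hβe⟩, fun γ ⟨hγ0, hγe⟩ => ?_⟩
  change F γ = γ ^ 2 at hγe
  rcases le_total β γ with h | h
  · have h1 := hanti h
    rw [hβe, hγe] at h1
    exact le_antisymm ((sq_le_sq₀ hγ0.le hβ0.le).1 h1) h
  · have h1 := hanti h
    rw [hβe, hγe] at h1
    exact le_antisymm h ((sq_le_sq₀ hβ0.le hγ0.le).1 h1)

end Existence

end AoI

theorem lemma1 {Ω : Type*} [MeasurableSpace Ω] (P : Measure Ω) [IsProbabilityMeasure P]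
    (T C : ℕ → Ω → ℝ)
    (hT_meas : ∀ k, Measurable (T k)) (hC_meas : ∀ k, Measurable (C k))
    (hT_nonneg : ∀ k ω, 0 ≤ T k ω) (hC_nonneg : ∀ k ω, 0 ≤ C k ω)
    (h_indep : iIndepFun (fun k ω => (T k ω, C k ω)) P)
    (h_ident : ∀ k, 1 ≤ k →
      IdentDistrib (fun ω => (T k ω, C k ω)) (fun ω => (T 1 ω, C 1 ω)) P P)
    (hT_int : Integrable (T 1) P) (hC_int : Integrable (C 1) P)
    (h_mean : 0 < (∫ ω, T 1 ω ∂P) + (∫ ω, C 1 ω ∂P))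
    (h_init : MemLp (fun ω => T 0 ω + C 0 ω) 2 P) :
    (MemLp (fun ω => T 1 ω + C 1 ω) 2 P → ∃! β : ℝ, AoI.IsThreshold P (T 1) (C 1) β) ∧
    ∀ β : ℝ, AoI.IsThreshold P (T 1) (C 1) β →
      AoI.IsOptimalLongWait T C (AoI.stationary (AoI.thresholdRule β)) P ∧
      (∀ k ω, AoI.sendTime T C (AoI.stationary (AoI.thresholdRule β)) (k + 1) ω
          - AoI.sendTime T C (AoI.stationary (AoI.thresholdRule β)) k ω
        = max β (T k ω + C k ω)) ∧
      Tendsto (AoI.meanAge T C (AoI.stationary (AoI.thresholdRule β)) P) atTop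
        (𝓝 (ENNReal.ofReal (β + (∫ ω, T 1 ω ∂P) + (∫ ω, C 1 ω ∂P)))) ∧
      (∀ h : ℝ → ℝ → ℝ, AoI.IsOptimalLongWait T C (AoI.stationary h) P →
        ∀ᵐ ω ∂P, h (T 1 ω) (C 1 ω) = AoI.thresholdRule β (T 1 ω) (C 1 ω)) := by

  have hm : AoI.IsModel P T C := ⟨hT_meas, hC_meas, hT_nonneg, hC_nonneg, h_indep, h_ident,
    hT_int, hC_int, h_mean⟩
  refine ⟨fun hS => AoI.existsUnique_threshold
    (fun ω => add_nonneg (hT_nonneg 1 ω) (hC_nonneg 1 ω)) hS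
    (by rwa [integral_add hT_int hC_int]), fun β hβ => ?_⟩
  refine ⟨hβ.isOptimalLongWait hm h_init, fun k ω => ?_, ?_,
    fun h ho => hβ.ae_eq_of_optimal hm h_init ho⟩
  · rw [AoI.sendTime_succ, AoI.interval_threshold, add_sub_cancel_left]
  · rw [add_assoc, ENNReal.ofReal_add hβ.1.le h_mean.le]
    exact hβ.tendsto_meanAge hm h_init
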